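/- Let $\Gamma$ be a (finite, connected) distance-regular graph with vertex set $X$ and diameter $D\ge 3$, with intersection numbers $p^h_{i,j}$, valencies $k_i=p^0_{i,i}$ and distance matrices $A_0=I, A_1=A,\dots,A_D\in \mathrm{Mat}_X(\mathbb C)$. Let $\{E_i\}_{i=0}^D$ be an ordering of the primitive idempotents of the Bose–Mesner algebra $M=\mathrm{Span}\{A_i\}_{i=0}^D$, with $E_0=|X|^{-1}J$, where $J$ is the all-ones matrix. Let $P,Q$ be the first and second eigenmatrices: $A_j=\sum_{i=0}^D P_{i,j}E_i$ and $E_j=|X|^{-1}\sum_{i=0}^D Q_{i,j}A_i$. Assume that the ordering is formally self-dual, i.e. $P=Q$, and of $q$-Racah type: with $\theta_i=P_{i,1}=Q_{i,1}$, $$\theta_i=\alpha\,(a q^{2i-D}+a^{-1}q^{D-2i})+\varepsilon\qquad(0\le i\le D),$$ where $q,a,\alpha,\varepsilon\in\mathbb C$, $q,a,\alpha$ are nonzero and $q^2\neq 1$, $q^2\ne -1$. Fix $x\in X$. For $0\le i\le D$ let $E_i^*$ be the diagonal matrix with $(y,y)$-entry $1$ if the distance of $x$ and $y$ is $i$, and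 $0$ otherwise; let the dual distance matrix $A_i^*$ be the diagonal matrix with $(y,y)$-entry $|X|(E_i)_{x,y}$, and put $A^*=A_1^*$. Assume that $$\sum_{i=0}^D E^*_i\,\frac{A-\varepsilon I}{\alpha}\,E^*_i\Bigl(1+\frac{\theta_i-\varepsilon}{\alpha}\frac{1}{q+q^{-1}}\Bigr)=\sum_{i=0}^D E_i\,\frac{A^*-\varepsilon I}{\alpha}\,E_i\Bigl(1+\frac{\theta_i-\varepsilon}{\alpha}\frac{1}{q+q^{-1}}\Bigr).$$ Let $\tau_i=(-1)^i a^{-i}q^{i(D-i)}$ for $0\le i\le D$, let $0\ne f\in\mathbb C$, and put $$W=f\sum_{i=0}^D\tau_iE_i,\qquad W^*=f\sum_{i=0}^D\tau_iE_i^*.$$ Then $W$ and $W^*$ are invertible, $\sum_{i=0}^D\tau_ik_i\ne0$, $\sum_{i=0}^D\tau_i^{-1}k_i\neq 0$, and $$W=f\,\frac{\sum_{i=0}^D\tau_i^{-1}A_i}{\sum_{i=0}^D\tau_i^{-1}k_i},\qquad W^{-1}=\frac1f\,\frac{\sum_{i=0}^D\tau_iA_i}{\sum_{i=0}^D\tau_ik_i},$$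 $$W^*=f\,\frac{\sum_{i=0}^D\tau_i^{-1}A^*_i}{\sum_{i=0}^D\tau_i^{-1}k_i},\qquad (W^*)^{-1}=\frac1f\,\frac{\sum_{i=0}^D\tau_iA^*_i}{\sum_{i=0}^D\tau_ik_i}.$$ Consequently the entrywise product of $W$ and $W^{-1}$ is $$W\circ W^{-1}=|X|^{-1}J,$$ and $W$ is a type II matrix: all entries of $W$ are nonzero, and $W\,W^{(-)}$ is a scalar multiple of $I$, where $W^{(-)}$ has $(b,c)$-entry $1/W_{c,b}$ for $b,c\in X$. -/

import Mathlib

open scoped Matrix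

namespace DRG

noncomputable section

/-- `G` is distance-regular with intersection numbers `p h i j` (`0 ≤ h, i, j ≤ D`, where `D` is
the diameter): `G` is connected, and any two vertices `y, z` at distance `h` have exactly `p h i j`
vertices at distance `i` from `y` and `j` from `z`. The valencies are `k i = p 0 i i`. -/
structure IsDistanceRegularWith {X : Type*} [Fintype X] (G : SimpleGraph X)
    (p : ℕ → ℕ → ℕ → ℕ) : Prop where
  connected : G.Connected
  card_eq : ∀ h i j : ℕ, h ≤ G.diam → i ≤ G.diam → j ≤ G.diam →
    ∀ y z : X, G.dist y z = h →
      (Finset.univ.filter fun w : X => G.dist y w = i ∧ G.dist z w = j).card = p h i j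

/-- The all-ones matrix. -/
def allOnes (X : Type*) : Matrix X X ℂ := Matrix.of fun _ _ => 1

/-- The `i`th distance matrix; the adjacency matrix is the case `i = 1`. -/
def distMatrix {X : Type*} (G : SimpleGraph X) (i : ℕ) : Matrix X X ℂ :=
  Matrix.of fun y z => if G.dist y z = i then 1 else 0

/-- The Bose-Mesner algebra (as a space of matrices), spanned by the distance matrices. -/
def boseMesner {X : Type*} (G : SimpleGraph X) : Submodule ℂ (Matrix X X ℂ) :=
  Submodule.span ℂ (Set.range fun i : Fin (G.diam + 1) => distMatrix G i)

/-- `E 0, …, E D` is an ordering of the primitive idempotents of `G`, the trivial one first. -/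
structure IsPrimitiveIdempotents {X : Type*} [Fintype X] [DecidableEq X] (G : SimpleGraph X)
    (E : Fin (G.diam + 1) → Matrix X X ℂ) : Prop where
  linearIndependent : LinearIndependent ℂ E
  span_eq : Submodule.span ℂ (Set.range E) = boseMesner G
  zero_eq : E 0 = (Fintype.card X : ℂ)⁻¹ • allOnes X
  sum_eq : ∑ i, E i = 1
  transpose_eq : ∀ i, (E i)ᵀ = E i
  conj_eq : ∀ i, (E i).map (starRingEnd ℂ) = E i
  mul_eq : ∀ i j, E i * E j = if i = j then E i else 0

/-- `P` is the first eigenmatrix: `A_j = ∑ i, P i j • E i`. -/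
def IsFirstEigenmatrix {X : Type*} (G : SimpleGraph X) (E : Fin (G.diam + 1) → Matrix X X ℂ)
    (P : Matrix (Fin (G.diam + 1)) (Fin (G.diam + 1)) ℂ) : Prop :=
  ∀ j : Fin (G.diam + 1), distMatrix G (j : ℕ) = ∑ i, P i j • E i

/-- `Q` is the second eigenmatrix: `E_j = |X|⁻¹ ∑ i, Q i j • A_i`. -/
def IsSecondEigenmatrix {X : Type*} [Fintype X] (G : SimpleGraph X)
    (E : Fin (G.diam + 1) → Matrix X X ℂ)
    (Q : Matrix (Fin (G.diam + 1)) (Fin (G.diam + 1)) ℂ) : Prop :=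
  ∀ j : Fin (G.diam + 1),
    E j = (Fintype.card X : ℂ)⁻¹ • ∑ i : Fin (G.diam + 1), Q i j • distMatrix G (i : ℕ)

/-- The `i`th dual primitive idempotent with respect to the base vertex `x`. -/
def dualIdempotent {X : Type*} [DecidableEq X] (G : SimpleGraph X) (x : X) (i : ℕ) :
    Matrix X X ℂ :=
  Matrix.diagonal fun y => if G.dist x y = i then 1 else 0

/-- The dual distance matrix with respect to `x` that belongs to the primitive idempotent `Ei`:
the diagonal matrix with `(y, y)`-entry `|X| (Ei)_{x, y}`. -/
def dualDistMatrix {X : Type*} [Fintype X] [DecidableEq X] (x : X) (Ei : Matrix X X ℂ) :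
    Matrix X X ℂ :=
  Matrix.diagonal fun y => (Fintype.card X : ℂ) * Ei x y

/-- `τ_i = (-1)^i a^{-i} q^{i (D - i)}`. -/
def tau (D : ℕ) (a q : ℂ) (i : ℕ) : ℂ :=
  (-1) ^ i * a ^ (-(i : ℤ)) * q ^ ((i : ℤ) * ((D : ℤ) - (i : ℤ)))

/-- The matrix `W^(-)`, with `(a, b)`-entry `1 / W_{b, a}`. -/
def invEntriesTranspose {X : Type*} (W : Matrix X X ℂ) : Matrix X X ℂ :=
  Matrix.of fun a b => 1 / W b a

/-- Type II matrices: no entry is zero, and `W W^(-)` is a scalar multiple of the identity. -/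
def IsTypeII {X : Type*} [Fintype X] [DecidableEq X] (W : Matrix X X ℂ) : Prop :=
  (∀ a b, W a b ≠ 0) ∧
    W * invEntriesTranspose W ∈ Submodule.span ℂ ({1} : Set (Matrix X X ℂ))

end

end DRG

/-! Write `Θ` for the diagonal matrix of normalized eigenvalues `(θ_i - ε)/α`, `B` for the
normalized matrix of the `p^h_{1,j}`, `T` for `diag τ`, and `N = |X|`. Self-duality gives `P² = N`.
Expanding `A A_j` in the idempotents gives `ΘP = PB`, hence also `BP = PΘ`.

The hypothesis on the averages is needed only in column `x`. On the left only `i = 0` survives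
there; on the right `E_i A^* E_i` acts on `E_i x̂` as the scalar `p^i_{1,i}`. So the products
`B_{ii} (1 + Θ_{ii}/(q + q⁻¹))` do not depend on `i` (`weight_mul_intersection_eq`). This is the
diagonal condition under which `T B T⁻¹` is a scalar matrix minus a multiple of `qBΘ - q⁻¹ΘB`; off
the diagonal, the recurrence for `τ` suffices (`tau_conj_apply`). `T⁻¹ B T` has the same form with
`BΘ` and `ΘB` exchanged, and `P` intertwines these two products, so `TPT` commutes with `B`.

The all-ones vector is an eigenvector of `B`. Since `B` is tridiagonal with nonzero superdiagonal,
that eigenspace is a line, so `TPT` maps the all-ones vector to a multiple of itself. This says `Pτ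
= c τ⁻¹` (`eigenmatrix_mulVec_tau`), and applying `P` again gives `Pτ⁻¹ = (N/c) τ`. Row 0 of `P`
holds the valencies, which identifies `c` and `N/c` with the two denominators. Expanding `E_i` in
distance matrices then gives the formulas for `W^{±1}`, and the entries of `A_i^*` give those for
`W^*`. In `W ∘ W⁻¹` the factors `τ` cancel, leaving `1/N`; symmetry of `W⁻¹` makes `W` type II. -/

namespace DRG

/-! ### The sequence `τ` and the `q`-Racah eigenvalues -/

theorem tau_zero (D : ℕ) (a q : ℂ) : tau D a q 0 = 1 := by
  simp [tau]

theorem tau_ne_zero (D : ℕ) {a q : ℂ} (ha : a ≠ 0) (hq : q ≠ 0) (i : ℕ) : tau D a q i ≠ 0 := by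
  simp only [tau]
  exact mul_ne_zero (mul_ne_zero (by simp) (zpow_ne_zero _ ha)) (zpow_ne_zero _ hq)

theorem tau_succ (D : ℕ) {a q : ℂ} (ha : a ≠ 0) (hq : q ≠ 0) (i : ℕ) :
    tau D a q (i + 1) = -tau D a q i * a⁻¹ * (q ^ (2 * (i : ℤ) + 1 - D))⁻¹ := by
  simp only [tau]
  have h1 : a ^ (-((i + 1 : ℕ) : ℤ)) = a ^ (-(i : ℤ)) * a⁻¹ := by
    rw [← zpow_neg_one a, ← zpow_add₀ ha]; congr 1; push_cast; ring
  have h2 : q ^ (((i + 1 : ℕ) : ℤ) * ((D : ℤ) - ((i + 1 : ℕ) : ℤ)))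
      = q ^ ((i : ℤ) * ((D : ℤ) - i)) * (q ^ (2 * (i : ℤ) + 1 - D))⁻¹ := by
    rw [← zpow_neg, ← zpow_add₀ hq]; congr 1; push_cast; ring
  rw [h1, h2, pow_succ]; ring

theorem sq_sub_inv_sq_ne_zero {q : ℂ} (hq0 : q ≠ 0) (hq1 : q ^ 2 ≠ 1) (hq2 : q ^ 2 ≠ -1) :
    q ^ 2 - q⁻¹ ^ 2 ≠ 0 := by
  intro h
  have h3 : (q ^ 2 - 1) * (q ^ 2 + 1) = 0 := by
    have : q ^ 2 * (q ^ 2 - q⁻¹ ^ 2) = 0 := by rw [h, mul_zero]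
    field_simp at this
    linear_combination this
  rcases mul_eq_zero.mp h3 with h | h
  · exact hq1 (sub_eq_zero.mp h)
  · exact hq2 (eq_neg_of_add_eq_zero_left h)

theorem add_inv_ne_zero {q : ℂ} (hq0 : q ≠ 0) (hq2 : q ^ 2 ≠ -1) : q + q⁻¹ ≠ 0 := by
  intro h
  apply hq2
  have : q * (q + q⁻¹) = 0 := by rw [h, mul_zero]
  field_simp at this
  linear_combination this

/-- The eigenvalues of `q`-Racah type, normalized. -/
noncomputable def racahEigenvalue (D : ℕ) (a q : ℂ) (i : ℕ) : ℂ :=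
  a * q ^ (2 * (i : ℤ) - D) + a⁻¹ * q ^ ((D : ℤ) - 2 * i)

/-- Centred at `z = q^(2i+1-D)`, the power that also occurs in `τ_{i+1}/τ_i = -1/(az)`, so that
neighbouring eigenvalues and `τ`-ratios become rational in `a`, `q`, `z`. -/
theorem racahEigenvalue_eq (D : ℕ) {a q : ℂ} (hq : q ≠ 0) (i : ℕ) :
    racahEigenvalue D a q i = a * q ^ (2 * (i : ℤ) + 1 - D) * q⁻¹
      + a⁻¹ * (q ^ (2 * (i : ℤ) + 1 - D))⁻¹ * q := by
  have h1 : q ^ (2 * (i : ℤ) - D) = q ^ (2 * (i : ℤ) + 1 - D) * q⁻¹ := by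
    rw [← zpow_neg_one q, ← zpow_add₀ hq]; congr 1; ring
  have h2 : q ^ ((D : ℤ) - 2 * i) = (q ^ (2 * (i : ℤ) + 1 - D))⁻¹ * q := by
    rw [← zpow_neg]; nth_rw 3 [← zpow_one q]; rw [← zpow_add₀ hq]; congr 1; ring
  rw [racahEigenvalue, h1, h2]; ring

theorem racahEigenvalue_succ_eq (D : ℕ) {a q : ℂ} (hq : q ≠ 0) (i : ℕ) :
    racahEigenvalue D a q (i + 1) = a * q ^ (2 * (i : ℤ) + 1 - D) * q
      + a⁻¹ * (q ^ (2 * (i : ℤ) + 1 - D))⁻¹ * q⁻¹ := by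
  have h1 : q ^ (2 * ((i + 1 : ℕ) : ℤ) - D) = q ^ (2 * (i : ℤ) + 1 - D) * q := by
    nth_rw 3 [← zpow_one q]; rw [← zpow_add₀ hq]; congr 1; push_cast; ring
  have h2 : q ^ ((D : ℤ) - 2 * ((i + 1 : ℕ) : ℤ)) = (q ^ (2 * (i : ℤ) + 1 - D))⁻¹ * q⁻¹ := by
    rw [← zpow_neg, ← zpow_neg_one q, ← zpow_add₀ hq]; congr 1; push_cast; ring
  rw [racahEigenvalue, h1, h2]; ring

/-! ### Tridiagonal matrices and the identity `Pτ = c τ⁻¹` -/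

section Tridiagonal

variable {D : ℕ}

/-- Only the diagonal and the two neighbouring diagonals of `B` carry nonzero entries. -/
def IsTridiagonal (B : Matrix (Fin (D + 1)) (Fin (D + 1)) ℂ) : Prop :=
  ∀ i j : Fin (D + 1), (i : ℕ) + 1 < j ∨ (j : ℕ) + 1 < i → B i j = 0

/-- Conjugating a tridiagonal matrix by `diag τ` gives a `q`-commutator with `diag θ`, up to a
scalar, when the diagonal entries are as required. -/
theorem tau_conj_apply {a q : ℂ} (ha : a ≠ 0) (hq0 : q ≠ 0) (hq1 : q ^ 2 ≠ 1) (hq2 : q ^ 2 ≠ -1)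
    {B : Matrix (Fin (D + 1)) (Fin (D + 1)) ℂ} (hB : IsTridiagonal B) {g : ℂ}
    (hg : ∀ i, B i i * (1 + racahEigenvalue D a q i / (q + q⁻¹)) = g) (i j : Fin (D + 1)) :
    tau D a q i * B i j * (tau D a q j)⁻¹ = (if i = j then g else 0) -
      (q ^ 2 - q⁻¹ ^ 2)⁻¹ * (q * racahEigenvalue D a q j - q⁻¹ * racahEigenvalue D a q i) *
        B i j := by
  have hs := sq_sub_inv_sq_ne_zero hq0 hq1 hq2
  have hp := add_inv_ne_zero hq0 hq2
  have hm : q ^ 2 - q⁻¹ ^ 2 = (q + q⁻¹) * (q - q⁻¹) := by ring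
  have hm0 : q - q⁻¹ ≠ 0 := by intro h; rw [hm, h, mul_zero] at hs; exact hs rfl
  have hti := tau_ne_zero D ha hq0 i
  have htj := tau_ne_zero D ha hq0 j
  rcases lt_trichotomy (i : ℕ) j with h | h | h
  · have hij : i ≠ j := by rintro rfl; exact lt_irrefl _ h
    rcases Nat.lt_or_ge ((i : ℕ) + 1) j with h' | h'
    · rw [hB i j (Or.inl h')]; simp [hij]
    · have hj : (j : ℕ) = i + 1 := by omega
      have hz : q ^ (2 * (i : ℤ) + 1 - D) ≠ 0 := zpow_ne_zero _ hq0
      rw [hj, racahEigenvalue_succ_eq D hq0, racahEigenvalue_eq D hq0, tau_succ D ha hq0,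
        if_neg hij]
      -- Here `τ_i/τ_{i+1} = -az`, while the `q`-difference of the eigenvalues is `az(q² - q⁻²)`.
      -- Below the diagonal `az` is replaced by its inverse.
      generalize q ^ (2 * (i : ℤ) + 1 - D) = z at *
      have : q * (a * z * q + a⁻¹ * z⁻¹ * q⁻¹) - q⁻¹ * (a * z * q⁻¹ + a⁻¹ * z⁻¹ * q)
          = a * z * (q ^ 2 - q⁻¹ ^ 2) := by field_simp; ring
      rw [this]
      generalize q ^ 2 - q⁻¹ ^ 2 = s at *
      field_simp
      ring
  · have hij : i = j := Fin.ext h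
    subst hij
    -- On the diagonal the coefficient is `(q - q⁻¹)/(q² - q⁻²) = 1/(q + q⁻¹)`, the one in `hg`.
    rw [if_pos rfl, ← hg i, hm]
    field_simp
    ring
  · have hij : i ≠ j := by rintro rfl; exact lt_irrefl _ h
    rcases Nat.lt_or_ge ((j : ℕ) + 1) i with h' | h'
    · rw [hB i j (Or.inr h')]; simp [hij]
    · have hj : (i : ℕ) = j + 1 := by omega
      have hz : q ^ (2 * (j : ℤ) + 1 - D) ≠ 0 := zpow_ne_zero _ hq0
      rw [hj, racahEigenvalue_succ_eq D hq0, racahEigenvalue_eq D hq0, tau_succ D ha hq0,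
        if_neg hij]
      generalize q ^ (2 * (j : ℤ) + 1 - D) = z at *
      have : q * (a * z * q⁻¹ + a⁻¹ * z⁻¹ * q) - q⁻¹ * (a * z * q + a⁻¹ * z⁻¹ * q⁻¹)
          = a⁻¹ * z⁻¹ * (q ^ 2 - q⁻¹ ^ 2) := by field_simp; ring
      rw [this]
      generalize q ^ 2 - q⁻¹ ^ 2 = s at *
      field_simp
      ring

/-- An eigenvector of a tridiagonal matrix with nonzero superdiagonal is zero if its first entry
is. -/
theorem IsTridiagonal.eq_zero_of_mulVec {B : Matrix (Fin (D + 1)) (Fin (D + 1)) ℂ}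
    (hB : IsTridiagonal B) (hb : ∀ i j : Fin (D + 1), (j : ℕ) = i + 1 → B i j ≠ 0)
    {t : ℂ} {d : Fin (D + 1) → ℂ} (hd : B *ᵥ d = t • d) (hd0 : d 0 = 0) : d = 0 := by
  have key : ∀ n : ℕ, ∀ i : Fin (D + 1), (i : ℕ) ≤ n → d i = 0 := by
    intro n
    induction n with
    | zero =>
      intro i hi
      have : i = 0 := Fin.ext (by simpa using hi)
      rw [this, hd0]
    | succ n ih =>
      intro j hj
      rcases Nat.lt_or_ge n j with h | h
      · have hjn : (j : ℕ) = n + 1 := by omega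
        have hlt : n < D + 1 := by have := j.2; omega
        have h1 := congrFun hd ⟨n, hlt⟩
        -- Row `n` is a three-term recurrence: with the earlier entries zero, only the superdiagonal
        -- term in `d j`, `j = n + 1`, survives.
        rw [Pi.smul_apply, ih ⟨n, hlt⟩ le_rfl, smul_zero, Matrix.mulVec, dotProduct,
          Finset.sum_eq_single j] at h1
        · exact (mul_eq_zero.mp h1).resolve_left (hb _ _ hjn)
        · intro m _ hm
          rcases Nat.lt_or_ge n m with h2 | h2
          · rw [hB _ _ (Or.inl ?_), zero_mul]
            have : (m : ℕ) ≠ j := fun h => hm (Fin.ext h)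
            simp only
            omega
          · rw [ih m h2, mul_zero]
        · simp
      · exact ih j h
  funext i
  exact key i i le_rfl

/-- The eigenmatrix sends `τ` to a multiple of `τ⁻¹`. -/
theorem eigenmatrix_mulVec_tau {a q : ℂ} (ha : a ≠ 0) (hq0 : q ≠ 0) (hq1 : q ^ 2 ≠ 1)
    (hq2 : q ^ 2 ≠ -1) {P B : Matrix (Fin (D + 1)) (Fin (D + 1)) ℂ} {N : ℂ} (hN : N ≠ 0)
    (hPP : P * P = N • 1)
    (hPB : Matrix.diagonal (fun i : Fin (D + 1) => racahEigenvalue D a q i) * P = P * B)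
    (hP0 : ∀ i, P i 0 = 1) (hB : IsTridiagonal B)
    (hb : ∀ i j : Fin (D + 1), (j : ℕ) = i + 1 → B i j ≠ 0) {g : ℂ}
    (hg : ∀ i, B i i * (1 + racahEigenvalue D a q i / (q + q⁻¹)) = g) :
    ∃ c : ℂ, c ≠ 0 ∧ ∀ i : Fin (D + 1), ∑ j, P i j * tau D a q j = c * (tau D a q i)⁻¹ := by
  set Θ := Matrix.diagonal (fun i : Fin (D + 1) => racahEigenvalue D a q i) with hΘ
  set T := Matrix.diagonal (fun i : Fin (D + 1) => tau D a q i) with hT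
  set T' := Matrix.diagonal (fun i : Fin (D + 1) => (tau D a q i)⁻¹) with hT'
  have ht := fun i : Fin (D + 1) => tau_ne_zero D ha hq0 (i : ℕ)
  have hTT' : T * T' = 1 := by
    rw [hT, hT', Matrix.diagonal_mul_diagonal, ← Matrix.diagonal_one]
    congr 1; funext i; exact mul_inv_cancel₀ (ht i)
  have hT'T : T' * T = 1 := by
    rw [hT, hT', Matrix.diagonal_mul_diagonal, ← Matrix.diagonal_one]
    congr 1; funext i; exact inv_mul_cancel₀ (ht i)
  have hBP : B * P = P * Θ := by
    have h : P * (B * P) = P * (P * Θ) := by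
      rw [← mul_assoc, ← hPB, mul_assoc, hPP, ← mul_assoc, hPP]; simp
    have h2 : P * P * (B * P) = P * P * (P * Θ) := by rw [mul_assoc, h, mul_assoc]
    rw [hPP, smul_mul_assoc, smul_mul_assoc, one_mul, one_mul] at h2
    exact smul_right_injective _ hN h2
  set s := (q ^ 2 - q⁻¹ ^ 2)⁻¹ with hs
  have hC1 : T * B * T' = g • 1 - s • (q • (B * Θ) - q⁻¹ • (Θ * B)) := by
    ext i j
    simp only [hT, hT', hΘ, Matrix.mul_diagonal, Matrix.diagonal_mul, Matrix.sub_apply,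
      Matrix.smul_apply, smul_eq_mul, Matrix.one_apply]
    rw [tau_conj_apply ha hq0 hq1 hq2 hB hg, mul_ite, mul_one, mul_zero]
    ring
  have hC2 : T' * B * T = g • 1 - s • (q • (Θ * B) - q⁻¹ • (B * Θ)) := by
    -- `T'BT` is the transpose of `T Bᵀ T'`, and `Bᵀ` has the same diagonal as `B`.
    have hBt : IsTridiagonal Bᵀ := fun i j h => hB j i h.symm
    ext i j
    simp only [hT, hT', hΘ, Matrix.mul_diagonal, Matrix.diagonal_mul, Matrix.sub_apply,
      Matrix.smul_apply, smul_eq_mul, Matrix.one_apply]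
    have h := tau_conj_apply ha hq0 hq1 hq2 hBt (g := g) hg j i
    rw [Matrix.transpose_apply] at h
    simp only [eq_comm (a := j) (b := i)] at h
    rw [mul_ite, mul_one, mul_zero]
    linear_combination h
  -- `P` carries `BΘ` to `ΘB` and `ΘB` to `BΘ`, hence one `q`-commutator to the other.
  have hPC : P * (T * B * T') = (T' * B * T) * P := by
    have e1 : P * (B * Θ) = Θ * B * P := by rw [← mul_assoc, ← hPB, mul_assoc, mul_assoc, hBP]
    have e2 : P * (Θ * B) = B * Θ * P := by rw [← mul_assoc, ← hBP, mul_assoc, mul_assoc, hPB]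
    rw [hC1, hC2]
    simp only [mul_sub, sub_mul, Matrix.mul_smul, Matrix.smul_mul, mul_one, one_mul, e1, e2]
  have hI : (fun _ => 1 : Fin (D + 1) → ℂ) = P *ᵥ Pi.single 0 1 := by
    funext i; simp [hP0]
  -- The all-ones vector is `P e₀`, and `BP = PΘ` turns the eigenvector `e₀` of `Θ` into one of `B`.
  have hB1 : B *ᵥ (fun _ => 1) = racahEigenvalue D a q 0 • (fun _ => 1 : Fin (D + 1) → ℂ) := by
    rw [hI, Matrix.mulVec_mulVec, hBP, ← Matrix.mulVec_mulVec, hΘ,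
      Matrix.diagonal_mulVec_single, mul_one, ← Matrix.mulVec_smul]
    congr 1
    rw [← Pi.single_smul]; simp
  have hw : B *ᵥ ((T * P * T) *ᵥ fun _ => 1)
      = racahEigenvalue D a q 0 • ((T * P * T) *ᵥ fun _ => 1) := by
    rw [← Matrix.mulVec_smul, ← hB1, Matrix.mulVec_mulVec, Matrix.mulVec_mulVec]
    congr 1
    calc B * (T * P * T) = T * T' * (B * (T * P * T)) := by rw [hTT', one_mul]
      _ = T * (T' * B * T * P) * T := by simp only [mul_assoc]
      _ = T * P * T * B * (T' * T) := by rw [← hPC]; simp only [mul_assoc]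
      _ = T * P * T * B := by rw [hT'T, mul_one]
  have hTP : ∀ i, ((T * P * T) *ᵥ fun _ => 1) i = tau D a q i * ∑ j, P i j * tau D a q j := by
    intro i
    simp only [Matrix.mulVec, dotProduct, hT, Matrix.mul_diagonal, Matrix.diagonal_mul, mul_one,
      mul_assoc, Finset.mul_sum]
  set w := (T * P * T) *ᵥ fun _ => (1 : ℂ) with hwdef
  have hd : w - w 0 • (fun _ => 1) = 0 := by
    apply hB.eq_zero_of_mulVec hb (t := racahEigenvalue D a q 0)
    · rw [Matrix.mulVec_sub, Matrix.mulVec_smul, hB1, hw, smul_sub, smul_comm]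
    · simp
  have hwi : ∀ i, w i = w 0 := fun i => by
    have := congrFun hd i
    simpa [sub_eq_zero] using this
  have hfin : ∀ i : Fin (D + 1), ∑ j, P i j * tau D a q j = w 0 * (tau D a q i)⁻¹ := by
    intro i
    rw [← hwi i, hTP]
    field_simp [ht i]
  refine ⟨w 0, fun h0 => ?_, hfin⟩
  -- A zero constant would give `Pτ = 0`, against `P² = N` and `τ_0 = 1`.
  have hz : P *ᵥ (fun j : Fin (D + 1) => tau D a q j) = 0 := by
    funext i
    simpa [h0, Matrix.mulVec, dotProduct] using hfin i
  have h2 : (P * P) *ᵥ (fun j : Fin (D + 1) => tau D a q j) = 0 := by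
    rw [← Matrix.mulVec_mulVec, hz, Matrix.mulVec_zero]
  rw [hPP, Matrix.smul_mulVec, Matrix.one_mulVec] at h2
  have := congrFun h2 0
  simp [hN, tau_zero] at this

end Tridiagonal

/-! ### Distances and intersection numbers -/

section Graph

variable {X : Type*} {G : SimpleGraph X}

theorem exists_adj_dist_of_dist_eq_succ (hc : G.Connected) {y w : X} {i : ℕ}
    (h : G.dist y w = i + 1) : ∃ u, G.Adj u w ∧ G.dist y u = i := by
  obtain ⟨r, hr⟩ := hc.exists_walk_length_eq_dist w y
  rw [SimpleGraph.dist_comm, h] at hr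
  cases r with
  | nil => simp at hr
  | @cons _ u _ hadj r =>
    rw [SimpleGraph.Walk.length_cons] at hr
    refine ⟨u, hadj.symm, ?_⟩
    have h1 : G.dist u y ≤ i := (SimpleGraph.dist_le r).trans (by omega)
    have h2 : G.dist y w ≤ G.dist y u + G.dist u w := hc.dist_triangle
    rw [SimpleGraph.dist_eq_one_iff_adj.mpr hadj.symm] at h2
    rw [SimpleGraph.dist_comm] at h1
    omega

theorem sum_smul_distMatrix_apply (c : Fin (G.diam + 1) → ℂ) (y z : X) {d : Fin (G.diam + 1)}
    (hd : (d : ℕ) = G.dist y z) :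
    (∑ h : Fin (G.diam + 1), c h • distMatrix G (h : ℕ)) y z = c d := by
  rw [Matrix.sum_apply, Finset.sum_eq_single d]
  · simp [distMatrix, hd]
  · intro h _ hne
    have : G.dist y z ≠ h := fun e => hne (Fin.ext (hd.trans e).symm)
    simp [distMatrix, this]
  · simp

theorem distMatrix_zero [DecidableEq X] (hc : G.Connected) : distMatrix G 0 = 1 := by
  ext y z
  simp [distMatrix, hc.dist_eq_zero_iff, Matrix.one_apply]

variable [Fintype X] {p : ℕ → ℕ → ℕ → ℕ}

theorem IsDistanceRegularWith.nonempty (hG : IsDistanceRegularWith G p) : Nonempty X :=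
  hG.connected.nonempty

theorem card_ne_zero (hG : IsDistanceRegularWith G p) : (Fintype.card X : ℂ) ≠ 0 :=
  haveI := hG.nonempty
  Nat.cast_ne_zero.mpr Fintype.card_ne_zero

theorem IsDistanceRegularWith.dist_le_diam (hG : IsDistanceRegularWith G p) (y z : X) :
    G.dist y z ≤ G.diam :=
  haveI := hG.nonempty
  SimpleGraph.dist_le_diam (SimpleGraph.connected_iff_ediam_ne_top.mp hG.connected)

/-- An endpoint of a diametral pair works: walking back along a geodesic from the other end meets
every smaller distance. -/
theorem IsDistanceRegularWith.exists_forall_exists_dist_eq (hG : IsDistanceRegularWith G p) :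
    ∃ y : X, ∀ i ≤ G.diam, ∃ w, G.dist y w = i := by
  have := hG.nonempty
  obtain ⟨y, z, hyz⟩ := G.exists_dist_eq_diam
  refine ⟨y, fun i hi => ?_⟩
  induction hi using Nat.decreasingInduction with
  | self => exact ⟨z, hyz⟩
  | of_succ i _ ih =>
    obtain ⟨w, hw⟩ := ih
    obtain ⟨u, -, hu⟩ := exists_adj_dist_of_dist_eq_succ hG.connected hw
    exact ⟨u, hu⟩

theorem IsDistanceRegularWith.valency_ne_zero (hG : IsDistanceRegularWith G p) {i : ℕ}
    (hi : i ≤ G.diam) : p 0 i i ≠ 0 := by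
  obtain ⟨y, hy⟩ := hG.exists_forall_exists_dist_eq
  obtain ⟨w, hw⟩ := hy i hi
  rw [← hG.card_eq 0 i i (Nat.zero_le _) hi hi y y (by simp)]
  exact Finset.card_ne_zero_of_mem (a := w) (by simp [hw])

theorem IsDistanceRegularWith.intersection_succ_ne_zero (hG : IsDistanceRegularWith G p) {i : ℕ}
    (hi : i + 1 ≤ G.diam) : p i 1 (i + 1) ≠ 0 := by
  obtain ⟨y, hy⟩ := hG.exists_forall_exists_dist_eq
  obtain ⟨w, hw⟩ := hy _ hi
  obtain ⟨u, hadj, hu⟩ := exists_adj_dist_of_dist_eq_succ hG.connected hw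
  rw [← hG.card_eq i 1 (i + 1) (by omega) (by omega) hi u y (by rw [SimpleGraph.dist_comm, hu])]
  exact Finset.card_ne_zero_of_mem (a := w)
    (by simp [hw, SimpleGraph.dist_eq_one_iff_adj.mpr hadj])

theorem IsDistanceRegularWith.intersection_eq_zero (hG : IsDistanceRegularWith G p)
    (hD : 1 ≤ G.diam) {i j : ℕ} (hi : i ≤ G.diam) (hj : j ≤ G.diam)
    (hij : i + 1 < j ∨ j + 1 < i) : p i 1 j = 0 := by
  obtain ⟨y, hy⟩ := hG.exists_forall_exists_dist_eq
  obtain ⟨u, hu⟩ := hy i hi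
  rw [← hG.card_eq i 1 j hi hD hj y u hu, Finset.card_eq_zero, Finset.filter_eq_empty_iff]
  rintro w - ⟨h1, h2⟩
  have t1 : G.dist u w ≤ G.dist u y + G.dist y w := hG.connected.dist_triangle
  have t2 : G.dist y u ≤ G.dist y w + G.dist w u := hG.connected.dist_triangle
  rw [SimpleGraph.dist_comm (u := u) (v := y)] at t1
  rw [SimpleGraph.dist_comm (u := w) (v := u)] at t2
  omega

theorem IsDistanceRegularWith.distMatrix_one_mul (hG : IsDistanceRegularWith G p)
    (hD : 1 ≤ G.diam) {j : ℕ} (hj : j ≤ G.diam) :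
    distMatrix G 1 * distMatrix G j
      = ∑ h : Fin (G.diam + 1), (p h 1 j : ℂ) • distMatrix G (h : ℕ) := by
  ext y z
  have hlt : G.dist y z < G.diam + 1 := Nat.lt_succ_of_le (hG.dist_le_diam y z)
  rw [sum_smul_distMatrix_apply _ y z (d := ⟨_, hlt⟩) rfl, ← hG.card_eq (G.dist y z) 1 j (hG.dist_le_diam y z) hD hj y z rfl, Matrix.mul_apply]
  simp only [distMatrix, Matrix.of_apply, mul_ite, mul_one, mul_zero]
  rw [Finset.card_filter]
  push_cast
  refine Finset.sum_congr rfl fun w _ => ?_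
  rw [SimpleGraph.dist_comm (u := w) (v := z)]
  by_cases h1 : G.dist y w = 1 <;> by_cases h2 : G.dist z w = j <;> simp [h1, h2]

theorem IsDistanceRegularWith.distMatrix_mul_allOnes (hG : IsDistanceRegularWith G p)
    {j : ℕ} (hj : j ≤ G.diam) :
    distMatrix G j * allOnes X = (p 0 j j : ℂ) • allOnes X := by
  ext y z
  rw [Matrix.mul_apply, ← hG.card_eq 0 j j (Nat.zero_le _) hj hj y y (by simp)]
  simp [distMatrix, allOnes]

end Graph

/-- The matrix of the intersection numbers `p h 1 j`. -/
def intersectionMatrix (p : ℕ → ℕ → ℕ → ℕ) (D : ℕ) : Matrix (Fin (D + 1)) (Fin (D + 1)) ℂ :=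
  Matrix.of fun h j => (p h 1 j : ℂ)

theorem IsSecondEigenmatrix.apply {X : Type*} [Fintype X] {G : SimpleGraph X}
    {E : Fin (G.diam + 1) → Matrix X X ℂ} {P : Matrix (Fin (G.diam + 1)) (Fin (G.diam + 1)) ℂ}
    (hQ : IsSecondEigenmatrix G E P) (j : Fin (G.diam + 1)) (y z : X) {d : Fin (G.diam + 1)} (hd : (d : ℕ) = G.dist y z) :
    E j y z = (Fintype.card X : ℂ)⁻¹ * P d j := by
  rw [hQ j, Matrix.smul_apply, sum_smul_distMatrix_apply (fun i => P i j) y z hd, smul_eq_mul]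

/-! ### Eigenmatrix identities and the averages at the base vertex -/

section Eigenmatrix

variable {X : Type*} [Fintype X] [DecidableEq X] {G : SimpleGraph X} {p : ℕ → ℕ → ℕ → ℕ}
  {E : Fin (G.diam + 1) → Matrix X X ℂ} {P : Matrix (Fin (G.diam + 1)) (Fin (G.diam + 1)) ℂ}

theorem IsPrimitiveIdempotents.eq_of_sum_smul_eq (hE : IsPrimitiveIdempotents G E)
    {c d : Fin (G.diam + 1) → ℂ} (h : ∑ i, c i • E i = ∑ i, d i • E i) (i : Fin (G.diam + 1)) :
    c i = d i := by
  have := Fintype.linearIndependent_iff.mp hE.linearIndependent (fun i => c i - d i)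
    (by simp only [sub_smul, Finset.sum_sub_distrib, h, sub_self]) i
  exact sub_eq_zero.mp this

theorem IsPrimitiveIdempotents.sum_smul_mul_sum_smul (hE : IsPrimitiveIdempotents G E)
    (c d : Fin (G.diam + 1) → ℂ) :
    (∑ i, c i • E i) * (∑ i, d i • E i) = ∑ i, (c i * d i) • E i := by
  rw [Finset.sum_mul]
  refine Finset.sum_congr rfl fun i _ => ?_
  rw [Finset.mul_sum, Finset.sum_eq_single i]
  · rw [smul_mul_smul_comm, hE.mul_eq, if_pos rfl]
  · intro j _ hj
    rw [smul_mul_smul_comm, hE.mul_eq, if_neg hj.symm, smul_zero]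
  · simp

theorem IsFirstEigenmatrix.apply_zero (hG : IsDistanceRegularWith G p)
    (hE : IsPrimitiveIdempotents G E) (hP : IsFirstEigenmatrix G E P) (i : Fin (G.diam + 1)) :
    P i 0 = 1 := by
  refine hE.eq_of_sum_smul_eq (c := fun i => P i 0) (d := fun _ => 1) ?_ i
  rw [← hP 0]
  simp only [one_smul, hE.sum_eq, Fin.val_zero, distMatrix_zero hG.connected]

/-- Both sides are the eigenvalue of `A_j` on `E 0`, a multiple of `J`, whose image under `A_j` is
given by row sums. -/
theorem IsFirstEigenmatrix.zero_apply (hG : IsDistanceRegularWith G p)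
    (hE : IsPrimitiveIdempotents G E) (hP : IsFirstEigenmatrix G E P) (j : Fin (G.diam + 1)) :
    P 0 j = p 0 j j := by
  have h1 : distMatrix G j * E 0 = P 0 j • E 0 := by
    rw [hP j, Finset.sum_mul, Finset.sum_eq_single 0]
    · rw [smul_mul_assoc, hE.mul_eq, if_pos rfl]
    · intro i _ hi
      rw [smul_mul_assoc, hE.mul_eq, if_neg hi, smul_zero]
    · simp
  rw [hE.zero_eq, Matrix.mul_smul, hG.distMatrix_mul_allOnes (Nat.le_of_lt_succ j.2)] at h1
  obtain ⟨y⟩ := hG.nonempty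
  have h2 := congrFun (congrFun h1 y) y
  have h3 := card_ne_zero hG
  simp only [Matrix.smul_apply, allOnes, Matrix.of_apply, smul_eq_mul, mul_one] at h2
  field_simp at h2
  exact h2.symm

theorem IsFirstEigenmatrix.mul_self (hG : IsDistanceRegularWith G p)
    (hE : IsPrimitiveIdempotents G E) (hP : IsFirstEigenmatrix G E P)
    (hQ : IsSecondEigenmatrix G E P) : P * P = (Fintype.card X : ℂ) • 1 := by
  have hN := card_ne_zero hG
  ext i j
  have h : ∑ i, (P * P) i j • E i = ∑ i, ((Fintype.card X : ℂ) • (1 : Matrix _ _ ℂ)) i j • E i := by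
    have h1 : ∑ i, ((Fintype.card X : ℂ) • (1 : Matrix _ _ ℂ)) i j • E i
        = (Fintype.card X : ℂ) • E j := by
      rw [Finset.sum_eq_single j]
      · simp
      · intro b _ hb; simp [hb]
      · simp
    rw [h1, hQ j, smul_smul, mul_inv_cancel₀ hN, one_smul]
    simp only [hP _, Finset.smul_sum, Matrix.mul_apply, Finset.sum_smul, smul_smul]
    rw [Finset.sum_comm]
    simp only [mul_comm]
  exact hE.eq_of_sum_smul_eq h i

theorem IsFirstEigenmatrix.diagonal_mul (hG : IsDistanceRegularWith G p)
    (hE : IsPrimitiveIdempotents G E) (hP : IsFirstEigenmatrix G E P) (hD : 1 ≤ G.diam) :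
    Matrix.diagonal (fun i => P i 1) * P = P * intersectionMatrix p G.diam := by
  -- In `Fin (D + 1)` the numeral 1 wraps around to 0 if `D = 0`.
  have hv : ((1 : Fin (G.diam + 1)) : ℕ) = 1 := by
    rw [Fin.val_one', Nat.mod_eq_of_lt (by omega)]
  ext i j
  have h := hG.distMatrix_one_mul hD (Nat.le_of_lt_succ j.2)
  have h1 := hP 1
  rw [hv] at h1
  rw [h1, hP j, hE.sum_smul_mul_sum_smul] at h
  rw [Matrix.diagonal_mul]
  refine hE.eq_of_sum_smul_eq (c := fun i => P i 1 * P i j)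
    (d := fun i => (P * intersectionMatrix p G.diam) i j) (h.trans ?_) i
  simp only [hP _, Finset.smul_sum, Matrix.mul_apply, Finset.sum_smul, smul_smul, intersectionMatrix, Matrix.of_apply]
  rw [Finset.sum_comm]
  simp only [mul_comm]

/-- The dual of the entries `a_i` of the intersection matrix: `E_i A^* E_i` acts on `E_i x̂` as
`a_i`. -/
theorem primitiveIdempotent_mul_dualDistMatrix_mul_apply (hG : IsDistanceRegularWith G p)
    (hE : IsPrimitiveIdempotents G E) (hP : IsFirstEigenmatrix G E P)
    (hQ : IsSecondEigenmatrix G E P) (hD : 1 ≤ G.diam) (x y : X) (i : Fin (G.diam + 1)) :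
    (E i * dualDistMatrix x (E 1) * E i) y x = (p i 1 i : ℂ) * E i y x := by
  have hN := card_ne_zero hG
  -- By self-duality the entries of `A^*` and of `E_i x̂` at distance `d` are `P d 1` and `P d i /
  -- N`; row `d` of `ΘP = PB`, before normalization, expands their product in the vectors `E_h x̂`.
  have h1 : ∀ z, (dualDistMatrix x (E 1) * E i) z x
      = (∑ h : Fin (G.diam + 1), (p h 1 i : ℂ) • E h) z x := by
    intro z
    let d : Fin (G.diam + 1) := ⟨G.dist x z, Nat.lt_succ_of_le (hG.dist_le_diam x z)⟩
    have hd : (d : ℕ) = G.dist x z := rfl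
    have hd' : (d : ℕ) = G.dist z x := by rw [hd, SimpleGraph.dist_comm]
    have h := congrFun (congrFun (hP.diagonal_mul hG hE hD) d) i
    rw [Matrix.diagonal_mul, Matrix.mul_apply] at h
    rw [dualDistMatrix, Matrix.diagonal_mul, hQ.apply 1 x z hd, hQ.apply i z x hd',
      Matrix.sum_apply]
    simp only [Matrix.smul_apply, hQ.apply _ z x hd', smul_eq_mul]
    rw [mul_inv_cancel_left₀ hN, mul_left_comm, h, Finset.mul_sum]
    refine Finset.sum_congr rfl fun h _ => ?_
    simp only [intersectionMatrix, Matrix.of_apply]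
    ring
  have h2 : (E i * dualDistMatrix x (E 1) * E i) y x
      = (E i * ∑ h : Fin (G.diam + 1), (p h 1 i : ℂ) • E h) y x := by
    rw [mul_assoc, Matrix.mul_apply, Matrix.mul_apply]
    simp only [h1]
  rw [h2, Finset.mul_sum, Finset.sum_eq_single i]
  · rw [Matrix.mul_smul, hE.mul_eq, if_pos rfl, Matrix.smul_apply, smul_eq_mul]
  · intro j _ hj
    rw [Matrix.mul_smul, hE.mul_eq, if_neg hj.symm, smul_zero]
  · simp

/-- Applied to the base vertex, the hypothesis on the two averages fixes the diagonal entries of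
the intersection matrix. -/
theorem weight_mul_intersection_eq (hG : IsDistanceRegularWith G p)
    (hE : IsPrimitiveIdempotents G E) (hP : IsFirstEigenmatrix G E P)
    (hQ : IsSecondEigenmatrix G E P) (hD : 1 ≤ G.diam) (x : X) (β ε : ℂ)
    (c : Fin (G.diam + 1) → ℂ)
    (hx : ∑ i : Fin (G.diam + 1), c i • (dualIdempotent G x i *
          (β • (distMatrix G 1 - ε • (1 : Matrix X X ℂ))) * dualIdempotent G x i) =
        ∑ i : Fin (G.diam + 1), c i • (E i *
          (β • (dualDistMatrix x (E 1) - ε • (1 : Matrix X X ℂ))) * E i))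
    (i : Fin (G.diam + 1)) :
    c i * (β * ((p i 1 i : ℂ) - ε)) = c 0 * (β * -ε) := by
  have hN := card_ne_zero hG
  have hcol : ∀ y, (∑ i : Fin (G.diam + 1), (c i * (β * ((p i 1 i : ℂ) - ε))) • E i) y x
      = (∑ i : Fin (G.diam + 1), (c 0 * (β * -ε)) • E i) y x := by
    intro y
    have h := congrFun (congrFun hx y) x
    -- Column `x` of `E_j^*` vanishes for `j ≠ 0`, and `A` has zero diagonal, so only `-c_0 β ε` at
    -- `x` remains, rewritten through `∑ E_i = 1`.
    have hl : (∑ i : Fin (G.diam + 1), c i • (dualIdempotent G x i *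
          (β • (distMatrix G 1 - ε • (1 : Matrix X X ℂ))) * dualIdempotent G x i)) y x
        = (∑ i : Fin (G.diam + 1), (c 0 * (β * -ε)) • E i) y x := by
      rw [← Finset.smul_sum, hE.sum_eq, Matrix.sum_apply, Finset.sum_eq_single 0]
      · simp only [dualIdempotent, Matrix.smul_apply, Matrix.mul_diagonal, Matrix.diagonal_mul,
          Matrix.sub_apply, smul_eq_mul, Fin.val_zero, if_true,
          hG.connected.dist_eq_zero_iff, Matrix.one_apply, distMatrix, Matrix.of_apply]
        by_cases hxy : y = x
        · subst hxy; simp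
        · have : x ≠ y := fun e => hxy e.symm
          simp [hxy, this]
      · intro j _ hj
        have : (0 : ℕ) ≠ j := fun e => hj (Fin.ext (by simpa using e.symm))
        simp [dualIdempotent, Matrix.mul_diagonal, this]
      · simp
    rw [hl] at h
    rw [h, Matrix.sum_apply, Matrix.sum_apply]
    refine Finset.sum_congr rfl fun i _ => ?_
    have h1 : E i * (β • (dualDistMatrix x (E 1) - ε • (1 : Matrix X X ℂ))) * E i
        = β • (E i * dualDistMatrix x (E 1) * E i - ε • E i) := by
      rw [Matrix.mul_smul, Matrix.smul_mul, mul_sub, sub_mul, Matrix.mul_smul, mul_one,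
        Matrix.smul_mul, hE.mul_eq, if_pos rfl]
    rw [h1, Matrix.smul_apply, Matrix.smul_apply, Matrix.smul_apply, Matrix.sub_apply,
      primitiveIdempotent_mul_dualDistMatrix_mul_apply hG hE hP hQ hD, Matrix.smul_apply]
    simp only [smul_eq_mul]
    ring
  have hpt : ∀ d : Fin (G.diam + 1) → ℂ, (E i * ∑ j, d j • E j) x x = d i * E i x x := by
    intro d
    rw [Finset.mul_sum, Finset.sum_eq_single i]
    · rw [Matrix.mul_smul, hE.mul_eq, if_pos rfl, Matrix.smul_apply, smul_eq_mul]
    · intro j _ hj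
      rw [Matrix.mul_smul, hE.mul_eq, if_neg hj.symm, smul_zero]
    · simp
  -- This entry is `k_i / N`; multiplying the two columns by `E i` and reading off entry `x`
  -- therefore isolates the `i`th coefficient.
  have hExx : E i x x ≠ 0 := by
    rw [hQ.apply i x x (d := 0) (by simp), hP.zero_apply hG hE]
    exact mul_ne_zero (inv_ne_zero hN)
      (Nat.cast_ne_zero.mpr (hG.valency_ne_zero (Nat.le_of_lt_succ i.2)))
  apply mul_right_cancel₀ hExx
  rw [← hpt (fun i => c i * (β * ((p i 1 i : ℂ) - ε))), ← hpt (fun _ => c 0 * (β * -ε)),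
    Matrix.mul_apply, Matrix.mul_apply]
  simp only [hcol]

end Eigenmatrix

/-- The entrywise inverse transpose of a symmetric matrix `W` is `N W⁻¹` if `W ∘ W⁻¹ = N⁻¹ J` and
`W⁻¹` is symmetric, so that `W` is type II. -/
theorem isTypeII_of_hadamard_inv {X : Type*} [Fintype X] [DecidableEq X] {W W' : Matrix X X ℂ}
    {N : ℂ} (hN : N ≠ 0) (hW : W * W' = 1) (hW' : W'ᵀ = W')
    (h : W ⊙ W' = N⁻¹ • allOnes X) : IsTypeII W := by
  have hent : ∀ b c, W b c * W' b c = N⁻¹ := fun b c => by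
    have := congrFun (congrFun h b) c
    simpa [allOnes, Matrix.hadamard_apply] using this
  have hne : ∀ b c, W b c ≠ 0 := fun b c h0 => by
    have := hent b c
    rw [h0, zero_mul] at this
    exact inv_ne_zero hN this.symm
  refine ⟨hne, ?_⟩
  have hinv : invEntriesTranspose W = N • W' := by
    ext b c
    have h1 := hent c b
    have h2 : W' c b = W' b c := congrFun (congrFun hW' b) c
    rw [h2] at h1
    have h3 := hne c b
    simp only [invEntriesTranspose, Matrix.of_apply, Matrix.smul_apply, smul_eq_mul]
    field_simp
    field_simp at h1
    linear_combination -h1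
  rw [hinv, Matrix.mul_smul, hW]
  exact Submodule.smul_mem _ _ (Submodule.mem_span_singleton_self _)

/-! ### Expansions of `W`, `W^*` and the eigenmatrix relation for the graph -/

theorem distMatrix_transpose {X : Type*} (G : SimpleGraph X) (i : ℕ) :
    (distMatrix G i)ᵀ = distMatrix G i := by
  ext y z
  simp [distMatrix, SimpleGraph.dist_comm]

theorem smul_sum_mul_smul_sum_inv {X : Type*} [Fintype X] [DecidableEq X] {G : SimpleGraph X}
    {E : Fin (G.diam + 1) → Matrix X X ℂ} (hE : IsPrimitiveIdempotents G E)
    {t : Fin (G.diam + 1) → ℂ} (ht : ∀ i, t i ≠ 0) {f : ℂ} (hf : f ≠ 0) :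
    (f • ∑ i, t i • E i) * (f⁻¹ • ∑ i, (t i)⁻¹ • E i) = 1 := by
  rw [smul_mul_smul_comm, mul_inv_cancel₀ hf, hE.sum_smul_mul_sum_smul, one_smul]
  simp only [mul_inv_cancel₀ (ht _), one_smul, hE.sum_eq]

theorem sum_smul_dualIdempotent {X : Type*} [Fintype X] [DecidableEq X] {G : SimpleGraph X}
    {p : ℕ → ℕ → ℕ → ℕ} (hG : IsDistanceRegularWith G p) (x : X) (c : Fin (G.diam + 1) → ℂ) :
    ∑ i : Fin (G.diam + 1), c i • dualIdempotent G x i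
      = Matrix.diagonal fun y => c ⟨G.dist x y, Nat.lt_succ_of_le (hG.dist_le_diam x y)⟩ := by
  ext y z
  rw [Matrix.sum_apply]
  by_cases hyz : y = z
  · subst hyz
    rw [Matrix.diagonal_apply_eq,
      Finset.sum_eq_single ⟨G.dist x y, Nat.lt_succ_of_le (hG.dist_le_diam x y)⟩]
    · simp [dualIdempotent]
    · intro h _ hne
      have : G.dist x y ≠ h := fun e => hne (Fin.ext e.symm)
      simp [dualIdempotent, this]
    · simp
  · rw [Matrix.diagonal_apply_ne _ hyz]
    exact Finset.sum_eq_zero fun i _ => by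
      rw [Matrix.smul_apply, dualIdempotent, Matrix.diagonal_apply_ne _ hyz, smul_zero]

theorem IsSecondEigenmatrix.sum_smul_eq {X : Type*} [Fintype X] {G : SimpleGraph X}
    {E : Fin (G.diam + 1) → Matrix X X ℂ} {P : Matrix (Fin (G.diam + 1)) (Fin (G.diam + 1)) ℂ}
    (hQ : IsSecondEigenmatrix G E P) (c : Fin (G.diam + 1) → ℂ) :
    ∑ i, c i • E i = (Fintype.card X : ℂ)⁻¹ •
      ∑ h : Fin (G.diam + 1), (∑ i, P h i * c i) • distMatrix G h := by
  simp only [hQ _, Finset.smul_sum, Finset.sum_smul, smul_smul]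
  rw [Finset.sum_comm]
  refine Finset.sum_congr rfl fun h _ => Finset.sum_congr rfl fun i _ => ?_
  congr 1; ring

theorem IsSecondEigenmatrix.sum_smul_dualDistMatrix {X : Type*} [Fintype X] [DecidableEq X]
    {G : SimpleGraph X} {p : ℕ → ℕ → ℕ → ℕ} (hG : IsDistanceRegularWith G p)
    {E : Fin (G.diam + 1) → Matrix X X ℂ} {P : Matrix (Fin (G.diam + 1)) (Fin (G.diam + 1)) ℂ}
    (hQ : IsSecondEigenmatrix G E P) (x : X) (c : Fin (G.diam + 1) → ℂ) :
    ∑ i, c i • dualDistMatrix x (E i) = Matrix.diagonal fun y =>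
      ∑ i, P ⟨G.dist x y, Nat.lt_succ_of_le (hG.dist_le_diam x y)⟩ i * c i := by
  have hN := card_ne_zero hG
  ext y z
  rw [Matrix.sum_apply]
  by_cases hyz : y = z
  · subst hyz
    rw [Matrix.diagonal_apply_eq]
    refine Finset.sum_congr rfl fun i _ => ?_
    rw [Matrix.smul_apply, dualDistMatrix, Matrix.diagonal_apply_eq,
      hQ.apply i x y (d := ⟨G.dist x y, Nat.lt_succ_of_le (hG.dist_le_diam x y)⟩) rfl, smul_eq_mul,
      mul_inv_cancel_left₀ hN, mul_comm]
  · rw [Matrix.diagonal_apply_ne _ hyz]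
    exact Finset.sum_eq_zero fun i _ => by
      rw [Matrix.smul_apply, dualDistMatrix, Matrix.diagonal_apply_ne _ hyz, smul_zero]

/-- Under the hypothesis on the two averages, the eigenmatrix sends `τ` to a multiple of `τ⁻¹`. -/
theorem exists_eigenmatrix_sum_tau {X : Type*} [Fintype X] [DecidableEq X] {G : SimpleGraph X}
    {p : ℕ → ℕ → ℕ → ℕ} (hG : IsDistanceRegularWith G p) (hD : 1 ≤ G.diam)
    {E : Fin (G.diam + 1) → Matrix X X ℂ} (hE : IsPrimitiveIdempotents G E)
    {P : Matrix (Fin (G.diam + 1)) (Fin (G.diam + 1)) ℂ}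
    (hP : IsFirstEigenmatrix G E P) (hQ : IsSecondEigenmatrix G E P)
    {q a α ε : ℂ} (hq0 : q ≠ 0) (hq1 : q ^ 2 ≠ 1) (hq2 : q ^ 2 ≠ -1) (ha : a ≠ 0) (hα : α ≠ 0)
    (hθ : ∀ i : Fin (G.diam + 1), P i 1 = α * racahEigenvalue G.diam a q i + ε)
    (x : X)
    (hx : ∑ i : Fin (G.diam + 1), (1 + (P i 1 - ε) / α * (1 / (q + q⁻¹))) •
          (dualIdempotent G x i * (α⁻¹ • (distMatrix G 1 - ε • (1 : Matrix X X ℂ))) *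
            dualIdempotent G x i) =
        ∑ i : Fin (G.diam + 1), (1 + (P i 1 - ε) / α * (1 / (q + q⁻¹))) •
          (E i * (α⁻¹ • (dualDistMatrix x (E 1) - ε • (1 : Matrix X X ℂ))) * E i)) :
    ∃ c : ℂ, c ≠ 0 ∧ ∀ i : Fin (G.diam + 1),
      ∑ j, P i j * tau G.diam a q j = c * (tau G.diam a q i)⁻¹ := by
  have hθ' : ∀ i : Fin (G.diam + 1), racahEigenvalue G.diam a q i = α⁻¹ * (P i 1 - ε) := by
    intro i; rw [hθ]; field_simp; ring
  have hBij : ∀ i j : Fin (G.diam + 1), i ≠ j →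
      (α⁻¹ • (intersectionMatrix p G.diam - ε • 1) : Matrix _ _ ℂ) i j = α⁻¹ * p i 1 j := by
    intro i j hij; simp [intersectionMatrix, hij]
  refine eigenmatrix_mulVec_tau ha hq0 hq1 hq2 (card_ne_zero hG) (hP.mul_self hG hE hQ)
    (B := α⁻¹ • (intersectionMatrix p G.diam - ε • 1)) ?_ (hP.apply_zero hG hE) ?_ ?_
    -- The constant `g` is `c_0 α⁻¹ (-ε)`, the value at `i = 0`.
    (weight_mul_intersection_eq hG hE hP hQ hD x α⁻¹ ε _ hx · |> Eq.trans ?_)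
  · have : Matrix.diagonal (fun i : Fin (G.diam + 1) => racahEigenvalue G.diam a q i)
        = α⁻¹ • (Matrix.diagonal (fun i => P i 1) - ε • 1) := by
      ext i j
      by_cases hij : i = j
      · subst hij; simp [hθ']
      · simp [hij]
    rw [this, Matrix.smul_mul, sub_mul, hP.diagonal_mul hG hE hD, Matrix.mul_smul, mul_sub]
    simp
  · intro i j h
    have hij : i ≠ j := by rintro rfl; omega
    rw [hBij i j hij, hG.intersection_eq_zero hD (Nat.le_of_lt_succ i.2) (Nat.le_of_lt_succ j.2) h]
    simp
  · intro i j h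
    have hij : i ≠ j := by rintro rfl; omega
    rw [hBij i j hij, h]
    exact mul_ne_zero (inv_ne_zero hα) (Nat.cast_ne_zero.mpr
      (hG.intersection_succ_ne_zero (by have := j.2; omega)))
  · rw [hθ']
    simp only [intersectionMatrix, Matrix.smul_apply, Matrix.sub_apply, Matrix.of_apply,
      Matrix.one_apply_eq, smul_eq_mul]
    ring

end DRG

/-! ### The main theorem -/

open DRG in
theorem proposition13p3 {X : Type*} [Fintype X] [DecidableEq X] (G : SimpleGraph X)
    -- a distance-regular graph of diameter at least 3
    (p : ℕ → ℕ → ℕ → ℕ) (hG : IsDistanceRegularWith G p) (hD : 3 ≤ G.diam)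
    -- an ordering of the primitive idempotents that is formally self-dual
    (E : Fin (G.diam + 1) → Matrix X X ℂ) (hE : IsPrimitiveIdempotents G E)
    (P Q : Matrix (Fin (G.diam + 1)) (Fin (G.diam + 1)) ℂ)
    (hP : IsFirstEigenmatrix G E P) (hQ : IsSecondEigenmatrix G E Q) (hPQ : P = Q)
    -- and of q-Racah type; the eigenvalues are `θ_i = P i 1 = Q i 1`
    (q a α ε : ℂ) (hq0 : q ≠ 0) (hq1 : q ^ 2 ≠ 1) (hq2 : q ^ 2 ≠ -1) (ha : a ≠ 0) (hα : α ≠ 0)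
    (hθ : ∀ i : Fin (G.diam + 1),
      P i 1 = α * (a * q ^ (2 * (i : ℤ) - (G.diam : ℤ)) +
        a⁻¹ * q ^ ((G.diam : ℤ) - 2 * (i : ℤ))) + ε)
    -- the assumption at the base vertex `x`
    (x : X)
    (hx : ∑ i : Fin (G.diam + 1), (1 + (P i 1 - ε) / α * (1 / (q + q⁻¹))) •
          (dualIdempotent G x i * (α⁻¹ • (distMatrix G 1 - ε • (1 : Matrix X X ℂ))) *
            dualIdempotent G x i) =
        ∑ i : Fin (G.diam + 1), (1 + (P i 1 - ε) / α * (1 / (q + q⁻¹))) •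
          (E i * (α⁻¹ • (dualDistMatrix x (E 1) - ε • (1 : Matrix X X ℂ))) * E i))
    -- the Boltzmann pair
    (f : ℂ) (hf : f ≠ 0) (W Wstar : Matrix X X ℂ)
    (hW : W = f • ∑ i : Fin (G.diam + 1), tau G.diam a q i • E i)
    (hWstar : Wstar = f • ∑ i : Fin (G.diam + 1), tau G.diam a q i • dualIdempotent G x i) :
    -- the inverses exist and the denominators do not vanish
    (IsUnit W ∧ IsUnit Wstar ∧
      ∑ i : Fin (G.diam + 1), tau G.diam a q i * (p 0 i i : ℂ) ≠ 0 ∧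
      ∑ i : Fin (G.diam + 1), (tau G.diam a q i)⁻¹ * (p 0 i i : ℂ) ≠ 0) ∧
    W = (f / ∑ i : Fin (G.diam + 1), (tau G.diam a q i)⁻¹ * (p 0 i i : ℂ)) •
        ∑ i : Fin (G.diam + 1), (tau G.diam a q i)⁻¹ • distMatrix G i ∧
    W⁻¹ = (f⁻¹ / ∑ i : Fin (G.diam + 1), tau G.diam a q i * (p 0 i i : ℂ)) •
        ∑ i : Fin (G.diam + 1), tau G.diam a q i • distMatrix G i ∧
    Wstar = (f / ∑ i : Fin (G.diam + 1), (tau G.diam a q i)⁻¹ * (p 0 i i : ℂ)) •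
        ∑ i : Fin (G.diam + 1), (tau G.diam a q i)⁻¹ • dualDistMatrix x (E i) ∧
    Wstar⁻¹ = (f⁻¹ / ∑ i : Fin (G.diam + 1), tau G.diam a q i * (p 0 i i : ℂ)) •
        ∑ i : Fin (G.diam + 1), tau G.diam a q i • dualDistMatrix x (E i) ∧
    W ⊙ W⁻¹ = (Fintype.card X : ℂ)⁻¹ • allOnes X ∧
    IsTypeII W := by
  subst hPQ
  have hN := card_ne_zero hG
  have ht := fun i : Fin (G.diam + 1) => tau_ne_zero G.diam ha hq0 (i : ℕ)
  obtain ⟨c, hc, hPt⟩ := exists_eigenmatrix_sum_tau hG (by omega) hE hP hQ hq0 hq1 hq2 ha hα hθ x hx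
  -- Apply `P` to `Pτ = c τ⁻¹` and use `P² = N`.
  have hPt' : ∀ i : Fin (G.diam + 1), ∑ j, P i j * (tau G.diam a q j)⁻¹
      = (Fintype.card X : ℂ) / c * tau G.diam a q i := by
    have h1 : P *ᵥ (fun j : Fin (G.diam + 1) => tau G.diam a q j)
        = c • fun j : Fin (G.diam + 1) => (tau G.diam a q j)⁻¹ := funext hPt
    have h2 := congrArg (P *ᵥ ·) h1
    simp only [Matrix.mulVec_mulVec, Matrix.mulVec_smul, hP.mul_self hG hE hQ, Matrix.smul_mulVec,
      Matrix.one_mulVec] at h2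
    intro i
    have h3 := congrFun h2 i
    simp only [Pi.smul_apply, smul_eq_mul, Matrix.mulVec, dotProduct] at h3
    rw [div_mul_eq_mul_div, h3, mul_div_cancel_left₀ _ hc]
  -- Row 0 of `Pτ = c τ⁻¹`, with `P 0 i = k_i` and `τ_0 = 1`.
  have hk : ∑ i : Fin (G.diam + 1), tau G.diam a q i * (p 0 i i : ℂ) = c := by
    simp only [← hP.zero_apply hG hE, mul_comm (tau _ _ _ _), hPt, Fin.val_zero, tau_zero, inv_one,
      mul_one]
  have hk' : ∑ i : Fin (G.diam + 1), (tau G.diam a q i)⁻¹ * (p 0 i i : ℂ)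
      = (Fintype.card X : ℂ) / c := by
    simp only [← hP.zero_apply hG hE, mul_comm (tau _ _ _ _)⁻¹, hPt', Fin.val_zero, tau_zero,
      mul_one]
  have hWA : W = (f * c / Fintype.card X) •
      ∑ i : Fin (G.diam + 1), (tau G.diam a q i)⁻¹ • distMatrix G i := by
    rw [hW, hQ.sum_smul_eq]
    simp only [hPt, mul_smul, ← Finset.smul_sum, div_eq_mul_inv]
    simp only [smul_smul]
    congr 1; ring
  have hWmul := smul_sum_mul_smul_sum_inv hE ht hf
  rw [← hW] at hWmul
  have hWinv : W⁻¹ = (f⁻¹ / c) • ∑ i : Fin (G.diam + 1), tau G.diam a q i • distMatrix G i := by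
    rw [Matrix.inv_eq_right_inv hWmul, hQ.sum_smul_eq]
    simp only [hPt', mul_smul, ← Finset.smul_sum]
    rw [smul_smul, smul_smul]
    congr 1; field_simp
  have hWs : Wstar = Matrix.diagonal fun y => f * tau G.diam a q (G.dist x y) := by
    rw [hWstar, sum_smul_dualIdempotent hG x (fun i => tau G.diam a q i), ← Matrix.diagonal_smul]
    rfl
  have hWsmul : Wstar * Matrix.diagonal (fun y => f⁻¹ * (tau G.diam a q (G.dist x y))⁻¹) = 1 := by
    rw [hWs, Matrix.diagonal_mul_diagonal, ← Matrix.diagonal_one]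
    congr 1; funext y
    have := tau_ne_zero G.diam ha hq0 (G.dist x y)
    field_simp
  have hhad : W ⊙ W⁻¹ = (Fintype.card X : ℂ)⁻¹ • allOnes X := by
    rw [hWinv, hWA]
    ext y z
    have hlt : G.dist y z < G.diam + 1 := Nat.lt_succ_of_le (hG.dist_le_diam y z)
    have := tau_ne_zero G.diam ha hq0 (G.dist y z)
    rw [Matrix.hadamard_apply, Matrix.smul_apply, Matrix.smul_apply,
      sum_smul_distMatrix_apply (fun i => (tau G.diam a q i)⁻¹) y z (d := ⟨_, hlt⟩) rfl,
      sum_smul_distMatrix_apply (fun i => tau G.diam a q i) y z (d := ⟨_, hlt⟩) rfl]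
    simp only [smul_eq_mul, Matrix.smul_apply, allOnes, Matrix.of_apply]
    field_simp
  have hWW : W * W⁻¹ = 1 := by rw [Matrix.inv_eq_right_inv hWmul, hWmul]
  rw [hk, hk']
  refine ⟨⟨IsUnit.of_mul_eq_one _ hWmul, IsUnit.of_mul_eq_one _ hWsmul, hc, div_ne_zero hN hc⟩,
    ?_, hWinv, ?_, ?_, hhad, isTypeII_of_hadamard_inv hN hWW ?_ hhad⟩
  · rw [div_div_eq_mul_div]; exact hWA
  · rw [hQ.sum_smul_dualDistMatrix hG, hWs, ← Matrix.diagonal_smul]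
    congr 1; funext y
    simp only [Pi.smul_apply, hPt', smul_eq_mul]
    field_simp
  · rw [Matrix.inv_eq_right_inv hWsmul, hQ.sum_smul_dualDistMatrix hG, ← Matrix.diagonal_smul]
    congr 1; funext y
    simp only [Pi.smul_apply, hPt, smul_eq_mul]
    field_simp
  · rw [hWinv, Matrix.transpose_smul, Matrix.transpose_sum]
    simp only [Matrix.transpose_smul, distMatrix_transpose]
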